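/- Let $n,L\ge 1$ and $0\le n_0\le n$ be integers, and let $\mathbf H\in\mathbb R^{L\times L}$ be an orthogonal matrix. **Model (DSBM).** For some number $m^*$ of classes, at each time $l=1,\dots,L$ every node $i\in\{1,\dots,n\}$ belongs to exactly one class $z^*_l(i)\in\{1,\dots,m^*\}$, and $\boldsymbol\Lambda^*_{i,j,l}=\mathbf G_{z^*_l(i),z^*_l(j),l}$ for $i\ne j$, $\boldsymbol\Lambda^*_{i,i,l}=0$, where $\mathbf G_{k,k',l}=\mathbf G_{k',k,l}\in[0,1]$. One observes $\mathbf B_{i,j,l}\in\{0,1\}$ with $\mathbf B_{i,j,l}=\mathbf B_{j,i,l}$, $\mathbf B_{i,i,l}=0$, where the $\mathbf B_{i,j,l}$, $i<j$, $1\le l\le L$, are independent Bernoulli$(\boldsymbol\Lambda^*_{i,j,l})$. Let $N=n(n-1)/2$, and let $\mathbf a,\boldsymbol\theta^*\in\mathbb R^{NL}$ be the vectors of the entries with $i<j$ of $\mathbf B$ and $\boldsymbol\Lambda^*$, respectively. **Clusterings.** Let $\mathcal Z(m,n,n_0,L)$ be the set of clusterings $z=(z_1,\dots,z_L)$, $z_l:\{1,\dots,n\}\to\{1,\dots,m\}$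 (equivalently, $L$-tuples of $n\times m$ membership matrices), such that $z_l(i)\ne z_{l+1}(i)$ for at most $n_0$ nodes $i$, for each $l=1,\dots,L-1$. With $M=m(m+1)/2$, a clustering $z$ is identified with the block diagonal matrix $\mathbf C\in\{0,1\}^{NL\times ML}$ whose $l$-th block has, in row $(i_1,i_2)$, $i_1<i_2$, and column $\{k_1,k_2\}$, $k_1\le k_2$, the entry $1$ if $\{z_l(i_1),z_l(i_2)\}=\{k_1,k_2\}$ and $0$ otherwise (clusterings are counted as tuples $z$). Put $\mathbf W=\mathbf H\otimes\mathbf I_M$. **Estimator.** Let $(\hat m,\hat J,\hat{\mathbf d},\hat{\mathbf C})$ be, for each value of the data, one of the minimizers of $$\|\mathbf a-\mathbf C\mathbf W^T\mathbf d\|^2+\mathrm{Pen}_0(|J|,m)$$ over $1\le m\le n$, $J\subseteq\{1,\dots,ML\}$, $\mathbf d\in\mathbb R^{ML}$ with $\mathbf d_{J^c}=0$, and $\mathbf C\in\mathcal Z(m,n,n_0,L)$. Here $\mathrm{Pen}_0$ is either $$11\log|\mathcal Z(m,n,n_0,L)|+\tfrac{11}{2}|J|\log\Big(\frac{25m^2L}{|J|}\Big)$$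 or the penalty $\mathrm{Pen}$ below. Let $\hat{\boldsymbol\Lambda}$ be the symmetric tensor with zero diagonal whose entries with $i<j$ are those of $\hat{\mathbf C}\hat{\mathbf W}^T\hat{\mathbf d}$, where $\hat{\mathbf W}=\mathbf H\otimes\mathbf I_{\hat m(\hat m+1)/2}$. **Claim.** Let $$\mathrm{Pen}(|J|,m)=11\Big[n\log m+n_0(L-1)\log\Big(\frac{mne}{n_0}\Big)+\frac{|J|}{2}\log\Big(\frac{25m^2L}{|J|}\Big)\Big],$$ where the second term is $0$ if $n_0=0$ and the terms with $|J|$ are $0$ if $J=\emptyset$. Then, for every $t>0$, with probability at least $1-9e^{-t}$, $$\frac{\|\hat{\boldsymbol\Lambda}-\boldsymbol\Lambda^*\|^2}{n^2L}\le\min_{m,J,\mathbf d,\mathbf C}\Big[\frac{6\|\mathbf C\mathbf W^T\mathbf d_{(J)}-\boldsymbol\theta^*\|^2}{n^2L}+\frac{4\,\mathrm{Pen}(|J|,m)}{n^2L}\Big]+\frac{38\,t}{n^2L},$$ and $$\mathbb E\,\frac{\|\hat{\boldsymbol\Lambda}-\boldsymbol\Lambda^*\|^2}{n^2L}\le\min_{m,J,\mathbf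 d,\mathbf C}\Big[\frac{6\|\mathbf C\mathbf W^T\mathbf d_{(J)}-\boldsymbol\theta^*\|^2}{n^2L}+\frac{4\,\mathrm{Pen}(|J|,m)}{n^2L}+\frac{342}{n^2L}\Big].$$ The minima are over $1\le m\le n$, $J\subseteq\{1,\dots,ML\}$, $\mathbf d\in\mathbb R^{ML}$ and $\mathbf C\in\mathcal Z(m,n,n_0,L)$; $\mathbf d_{(J)}$ is $\mathbf d$ with the entries outside $J$ set to zero, and norms are Euclidean (Frobenius). -/

import Mathlib

open MeasureTheory ProbabilityTheory
open scoped Kronecker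

noncomputable section

namespace DSBM

/-- Pairs of nodes `i₁ < i₂`; there are `N = n(n-1)/2` of them. -/
abbrev NodePair (n : ℕ) : Type := {p : Fin n × Fin n // p.1 < p.2}

/-- Unordered pairs of classes (possibly equal); there are `M = m(m+1)/2` of them. -/
abbrev ClassPair (m : ℕ) : Type := Sym2 (Fin m)

/-- Squared Euclidean norm of a real vector. -/
def sqNorm {ι : Type*} [Fintype ι] (v : ι → ℝ) : ℝ := ∑ i, v i ^ 2

/-- Tensors with entries `T i j l`, where `i, j` are nodes and `l` is a time index. -/
abbrev Tensor (n L : ℕ) : Type := Fin n → Fin n → Fin L → ℝ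

/-- Squared Frobenius norm of a tensor. -/
def Tensor.sqNorm {n L : ℕ} (T : Tensor n L) : ℝ := ∑ l, ∑ i, ∑ j, T i j l ^ 2

/-- The non-redundant entries (`i₁ < i₂`) of a tensor, as one vector. -/
def vectorize {n L : ℕ} (T : Tensor n L) : Fin L × NodePair n → ℝ :=
  fun p => T p.2.1.1 p.2.1.2 p.1

/-- Packing of a vector into a symmetric tensor with zero diagonal. -/
def pack {n L : ℕ} (θ : Fin L × NodePair n → ℝ) : Tensor n L := fun i j l =>
  if h : i < j then θ (l, ⟨(i, j), h⟩)
  else if h : j < i then θ (l, ⟨(j, i), h⟩)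
  else 0

/-- A dynamic clustering of `n` nodes into `m` classes at `L` times: `z l i` is the class of node
`i` at time `l`. This is the `L`-tuple of membership matrices `Z^(l) ∈ {0,1}^(n × m)` with exactly
one unit per row, in which `Z^(l) i k = 1` iff `z l i = k`. -/
abbrev Clustering (m n L : ℕ) : Type := Fin L → Fin n → Fin m

/-- The class `𝒵(m, n, n₀, L)`: at most `n₀` nodes change their membership between any two
consecutive times. -/
def limitedChange (m n n₀ L : ℕ) : Set (Clustering m n L) :=
  {z | ∀ l l' : Fin L, (l' : ℕ) = (l : ℕ) + 1 →
    (Finset.univ.filter fun i => z l i ≠ z l' i).card ≤ n₀}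

/-- The block diagonal matrix `C ∈ {0,1}^(NL × ML)` of a clustering: in block `l`, the entry at
nodes `(i₁, i₂)` and classes `{k₁, k₂}` is one iff `{z l i₁, z l i₂} = {k₁, k₂}`. -/
def clusterMatrix {m n L : ℕ} (z : Clustering m n L) :
    Matrix (Fin L × NodePair n) (Fin L × ClassPair m) ℝ :=
  Matrix.of fun p k =>
    if p.1 = k.1 ∧ s(z p.1 p.2.1.1, z p.1 p.2.1.2) = k.2 then 1 else 0

/-- `W = H ⊗ I_M`. -/
def transformMatrix {L : ℕ} (H : Matrix (Fin L) (Fin L) ℝ) (m : ℕ) :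
    Matrix (Fin L × ClassPair m) (Fin L × ClassPair m) ℝ :=
  H ⊗ₖ (1 : Matrix (ClassPair m) (ClassPair m) ℝ)

/-- `θ = C Wᵀ d`. -/
def fittedVector {m n L : ℕ} (H : Matrix (Fin L) (Fin L) ℝ) (z : Clustering m n L)
    (d : Fin L × ClassPair m → ℝ) : Fin L × NodePair n → ℝ :=
  (clusterMatrix z * (transformMatrix H m).transpose).mulVec d

/-- `d_(J)`: the entries of `d` outside `J` are set to zero. -/
def truncate {ι : Type*} [DecidableEq ι] (J : Finset ι) (d : ι → ℝ) : ι → ℝ :=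
  fun j => if j ∈ J then d j else 0

/-- The penalty `11 log |𝒵(m, n, n₀, L)| + (11/2) |J| log (25 m² L / |J|)` as a function of `m` and
`k = |J|`; the last term is zero for `|J| = 0`. -/
def cardPenalty (n n₀ L m k : ℕ) : ℝ :=
  11 * Real.log ((limitedChange m n n₀ L).ncard : ℝ)
    + 11 / 2 * (k : ℝ) * Real.log (25 * (m : ℝ) ^ 2 * (L : ℝ) / (k : ℝ))

/-- The explicit penalty
`11 [n log m + n₀ (L-1) log (m n e / n₀) + (|J|/2) log (25 m² L / |J|)]` as a function of `m` and
`k = |J|`; the second term is zero for `n₀ = 0` and the last one for `|J| = 0`. -/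
def explicitPenalty (n n₀ L m k : ℕ) : ℝ :=
  11 * ((n : ℝ) * Real.log (m : ℝ)
    + (n₀ : ℝ) * ((L : ℝ) - 1) * Real.log ((m : ℝ) * (n : ℝ) * Real.exp 1 / (n₀ : ℝ))
    + (k : ℝ) / 2 * Real.log (25 * (m : ℝ) ^ 2 * (L : ℝ) / (k : ℝ)))

/-- The variables `(m, C, J, d)` of the penalized least squares problem. -/
structure Params (n L : ℕ) where
  m : ℕ
  z : Clustering m n L
  J : Finset (Fin L × ClassPair m)
  d : Fin L × ClassPair m → ℝ

/-- The constraints `1 ≤ m ≤ n`, `C ∈ 𝒵(m, n, n₀, L)` and `d_{Jᶜ} = 0`. -/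
structure Params.Feasible {n L : ℕ} (n₀ : ℕ) (P : Params n L) : Prop where
  one_le : 1 ≤ P.m
  le_n : P.m ≤ n
  mem : P.z ∈ limitedChange P.m n n₀ L
  vanish : ∀ j, j ∉ P.J → P.d j = 0

/-- The objective `‖a - C Wᵀ d‖² + Pen(|J|, m)`. -/
def objective {n L : ℕ} (H : Matrix (Fin L) (Fin L) ℝ) (pen : ℕ → ℕ → ℝ)
    (a : Fin L × NodePair n → ℝ) (P : Params n L) : ℝ :=
  sqNorm (a - fittedVector H P.z P.d) + pen P.m P.J.card

/-- `P` is one of the solutions of the penalized least squares problem with data `a`. -/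
def IsSolution {n L : ℕ} (n₀ : ℕ) (H : Matrix (Fin L) (Fin L) ℝ) (pen : ℕ → ℕ → ℝ)
    (a : Fin L × NodePair n → ℝ) (P : Params n L) : Prop :=
  P.Feasible n₀ ∧ ∀ P' : Params n L, P'.Feasible n₀ → objective H pen a P ≤ objective H pen a P'

/-- The estimated tensor: `θ = C Wᵀ d` packed into a tensor. -/
def Params.tensor {n L : ℕ} (H : Matrix (Fin L) (Fin L) ℝ) (P : Params n L) : Tensor n L :=
  pack (fittedVector H P.z P.d)

/-- `Λ` is the tensor of connection probabilities of a dynamic stochastic block model with some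
number `m` of classes, memberships `z` and symmetric connectivity tensor `G`; there are no
self-loops. -/
def IsBlockTensor {n L : ℕ} (Λ : Tensor n L) : Prop :=
  ∃ (m : ℕ) (z : Clustering m n L) (G : Fin m → Fin m → Fin L → ℝ),
    (∀ k k' l, G k k' l = G k' k l) ∧ (∀ k k' l, G k k' l ∈ Set.Icc (0 : ℝ) 1) ∧
    ∀ i j l, Λ i j l = if i = j then 0 else G (z l i) (z l j) l

/-- `B` is the random adjacency tensor of a dynamic undirected network without self-loops whose
connections are independent with probabilities `Λ`. -/
structure IsNetwork {Ω : Type*} [MeasurableSpace Ω] (μ : Measure Ω) {n L : ℕ}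
    (B : Ω → Tensor n L) (Λ : Tensor n L) : Prop where
  measurable : ∀ i j l, Measurable fun ω => B ω i j l
  binary : ∀ ω i j l, B ω i j l = 0 ∨ B ω i j l = 1
  symm : ∀ ω i j l, B ω i j l = B ω j i l
  diag : ∀ ω i l, B ω i i l = 0
  prob : ∀ i j l, i < j → μ.real {ω | B ω i j l = 1} = Λ i j l
  indep : iIndepFun (fun (p : Fin L × NodePair n) (ω : Ω) => vectorize (B ω) p) μ

/-- The bracket on the right-hand side of the oracle inequalities:
`6 ‖C Wᵀ d_(J) - θ*‖² / (n² L) + 4 Pen(|J|, m) / (n² L)` with the explicit penalty. -/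
def oracleTerm {n L : ℕ} (n₀ : ℕ) (H : Matrix (Fin L) (Fin L) ℝ) (Λ : Tensor n L) {m : ℕ}
    (z : Clustering m n L) (J : Finset (Fin L × ClassPair m))
    (d : Fin L × ClassPair m → ℝ) : ℝ :=
  6 * sqNorm (fittedVector H z (truncate J d) - vectorize Λ) / ((n : ℝ) ^ 2 * (L : ℝ))
    + 4 * explicitPenalty n n₀ L m J.card / ((n : ℝ) ^ 2 * (L : ℝ))

end DSBM

end

noncomputable section

namespace DSBM

/-! ### Exponential moments of projections of sub-Gaussian vectors -/

/-! Let `ξ = a - θ*` be the noise, `x` the selected fit and `y` a fixed competitor. Minimality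
bounds `‖x - θ*‖²` by the error and penalty of `y` plus the inner product of `ξ` with `x - y`. For
each model `(m, z, J)` this difference lies in a space `V` of dimension at most `|J| + 1`, spanned
by `y` and the columns in `J`, so only `‖P_V ξ‖²` matters (`norm_sq_sub_le_of_penalized`).

The entries of `ξ` are independent, centred and of range one, hence `ξ` is sub-Gaussian with
variance proxy `1/4`, and Gaussian linearisation gives `E exp ‖P_V ξ‖² ≤ √2 ^ dim V`
(`lintegral_exp_norm_starProjection_sq_le`).

All models are handled at once by the sum `S` of `exp (‖P_V ξ‖² - pen / 4)`: it dominates the term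
of the selected model, and the penalty is large enough for `E S ≤ 4` (`sum_exp_neg_penalty_le`,
`integral_noiseSum_le`). The remainder is thus `16 log S` (`sqNorm_tensor_sub_le`); Markov's
inequality for `S` gives the deviation bound, and `log S ≤ S` gives the bound in expectation. The
explicit penalty dominates the cardinality penalty by counting clusterings, so both choices are
covered. -/

lemma integral_exp_sqrt_two_mul_gaussianReal (x : ℝ) :
    ∫ g, Real.exp (√2 * x * g) ∂gaussianReal 0 1 = Real.exp (x ^ 2) := by
  have h := mgf_gaussianReal (p := gaussianReal 0 1) (X := id) (μ := 0) (v := 1) (by simp)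
    (√2 * x)
  simp only [mgf, id] at h
  rw [h]
  congr 1
  have : √2 ^ 2 = 2 := Real.sq_sqrt (by norm_num)
  simp only [NNReal.coe_one, mul_pow, this]
  ring

lemma exp_sq_div_four_mul_gaussianPDFReal (x : ℝ) :
    gaussianPDFReal 0 1 x • Real.exp (x ^ 2 / 4)
      = (√(2 * Real.pi))⁻¹ * Real.exp (-(1 / 4) * x ^ 2) := by
  simp only [gaussianPDFReal, NNReal.coe_one, mul_one, sub_zero, smul_eq_mul]
  rw [mul_assoc, ← Real.exp_add]
  congr 2
  ring

lemma integral_exp_sq_div_four_gaussianReal :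
    ∫ g, Real.exp (g ^ 2 / 4) ∂gaussianReal 0 1 = √2 := by
  rw [integral_gaussianReal_eq_integral_smul (by norm_num)]
  simp_rw [exp_sq_div_four_mul_gaussianPDFReal]
  rw [integral_const_mul, integral_gaussian, ← Real.sqrt_inv, ← Real.sqrt_mul (by positivity)]
  congr 1
  field_simp
  norm_num

lemma integrable_exp_sq_div_four_gaussianReal :
    Integrable (fun g : ℝ => Real.exp (g ^ 2 / 4)) (gaussianReal 0 1) := by
  -- A non-integrable function would have integral `0`, whereas the value is `√2`.
  by_contra h
  have := integral_exp_sq_div_four_gaussianReal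
  rw [integral_undef h] at this
  exact (Real.sqrt_pos.mpr (by norm_num : (0 : ℝ) < 2)).ne this

lemma lintegral_pi_ofReal_prod {κ : Type*} [Fintype κ] (ν : Measure ℝ) [SigmaFinite ν]
    (f : κ → ℝ → ℝ) (hf : ∀ i, Integrable (f i) ν) (h0 : ∀ i x, 0 ≤ f i x) :
    ∫⁻ g, ENNReal.ofReal (∏ i, f i (g i)) ∂(Measure.pi fun _ : κ => ν)
      = ENNReal.ofReal (∏ i, ∫ x, f i x ∂ν) := by
  rw [← ofReal_integral_eq_lintegral_ofReal, integral_fintype_prod_eq_prod]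
  · exact Integrable.fintype_prod_dep hf
  · exact Filter.Eventually.of_forall fun g => Finset.prod_nonneg fun i _ => h0 i _

/-- If a random vector has the exponential moments of a sub-Gaussian vector with variance proxy
`1 / 4`, then the squared norm of its projection on an orthonormal family has an exponential moment
of order one. -/
lemma lintegral_exp_sum_inner_sq_le {Ω : Type*} [MeasurableSpace Ω] {μ : Measure Ω} [SFinite μ]
    {ι κ : Type*} [Fintype ι] [Fintype κ] {ξ : Ω → EuclideanSpace ℝ ι} (hξ : Measurable ξ)
    (hsub : ∀ v : EuclideanSpace ℝ ι,
      ∫⁻ ω, ENNReal.ofReal (Real.exp (inner ℝ v (ξ ω))) ∂μ ≤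
        ENNReal.ofReal (Real.exp (‖v‖ ^ 2 / 8)))
    {e : κ → EuclideanSpace ℝ ι} (he : Orthonormal ℝ e) :
    ∫⁻ ω, ENNReal.ofReal (Real.exp (∑ j, inner ℝ (e j) (ξ ω) ^ 2)) ∂μ ≤
      ENNReal.ofReal (√2 ^ Fintype.card κ) := by
  set γ : Measure (κ → ℝ) := Measure.pi fun _ => gaussianReal 0 1 with hγ
  -- Linearisation: `exp (x²)` is the Gaussian mean of `exp (√2 x g)`. After exchanging the
  -- integrals, `hsub` applies for each fixed `g` to the vector `∑ √2 g_j e_j`.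
  have h1 : ∀ ω, ENNReal.ofReal (Real.exp (∑ j, inner ℝ (e j) (ξ ω) ^ 2)) =
      ∫⁻ g, ENNReal.ofReal (Real.exp (inner ℝ (∑ j, (√2 * g j) • e j) (ξ ω))) ∂γ := by
    intro ω
    have := lintegral_pi_ofReal_prod (gaussianReal 0 1)
      (fun (j : κ) x => Real.exp (√2 * inner ℝ (e j) (ξ ω) * x))
      (fun j => integrable_exp_mul_gaussianReal _)
      (fun _ _ => (Real.exp_pos _).le)
    simp_rw [integral_exp_sqrt_two_mul_gaussianReal, ← Real.exp_sum] at this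
    rw [← this]
    refine lintegral_congr fun g => ?_
    simp_rw [sum_inner, real_inner_smul_left]
    congr 3 with j
    ring
  have hmeas : Measurable (Function.uncurry fun (ω : Ω) (g : κ → ℝ) =>
      ENNReal.ofReal (Real.exp (inner ℝ (∑ j, (√2 * g j) • e j) (ξ ω)))) := by
    unfold Function.uncurry
    have h2 : Measurable fun p : Ω × (κ → ℝ) => ξ p.1 := hξ.comp measurable_fst
    have h3 : Continuous fun g : κ → ℝ => ∑ j, (√2 * g j) • e j := by fun_prop
    have h4 : Measurable fun p : Ω × (κ → ℝ) => ∑ j, (√2 * p.2 j) • e j :=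
      h3.measurable.comp measurable_snd
    exact ((h4.inner h2).exp).ennreal_ofReal
  simp_rw [h1]
  rw [lintegral_lintegral_swap hmeas.aemeasurable]
  -- By orthonormality the squared norm is `2 ∑ g_j²`; division by `8` leaves `g_j² / 4`, below the
  -- threshold `g_j² / 2` of Gaussian integrability.
  have h5 : ∀ g : κ → ℝ, ‖∑ j, (√2 * g j) • e j‖ ^ 2 / 8 = ∑ j, g j ^ 2 / 4 := by
    intro g
    rw [← real_inner_self_eq_norm_sq, he.inner_sum, Finset.sum_div]
    refine Finset.sum_congr rfl fun j _ => ?_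
    have : √2 * √2 = 2 := Real.mul_self_sqrt (by norm_num)
    simp only [conj_trivial]
    linear_combination g j ^ 2 / 8 * this
  calc ∫⁻ g, ∫⁻ ω, ENNReal.ofReal (Real.exp (inner ℝ (∑ j, (√2 * g j) • e j) (ξ ω))) ∂μ ∂γ
      ≤ ∫⁻ g, ENNReal.ofReal (∏ j, Real.exp (g j ^ 2 / 4)) ∂γ := by
        refine lintegral_mono fun g => (hsub _).trans (le_of_eq ?_)
        rw [h5, Real.exp_sum]
    _ = ENNReal.ofReal (√2 ^ Fintype.card κ) := by
        rw [lintegral_pi_ofReal_prod (gaussianReal 0 1) (fun (_ : κ) x => Real.exp (x ^ 2 / 4))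
          (fun _ => integrable_exp_sq_div_four_gaussianReal) (fun _ _ => (Real.exp_pos _).le)]
        simp [integral_exp_sq_div_four_gaussianReal]

lemma lintegral_exp_norm_starProjection_sq_le {Ω : Type*} [MeasurableSpace Ω] {μ : Measure Ω}
    [SFinite μ] {ι : Type*} [Fintype ι] {ξ : Ω → EuclideanSpace ℝ ι} (hξ : Measurable ξ)
    (hsub : ∀ v : EuclideanSpace ℝ ι,
      ∫⁻ ω, ENNReal.ofReal (Real.exp (inner ℝ v (ξ ω))) ∂μ ≤
        ENNReal.ofReal (Real.exp (‖v‖ ^ 2 / 8)))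
    (V : Submodule ℝ (EuclideanSpace ℝ ι)) :
    ∫⁻ ω, ENNReal.ofReal (Real.exp (‖V.starProjection (ξ ω)‖ ^ 2)) ∂μ ≤
      ENNReal.ofReal (√2 ^ Module.finrank ℝ V) := by
  set b := stdOrthonormalBasis ℝ V
  have he : Orthonormal ℝ fun j => (b j : EuclideanSpace ℝ ι) :=
    b.orthonormal.comp_linearIsometry V.subtypeₗᵢ
  have h := lintegral_exp_sum_inner_sq_le hξ hsub he
  rw [Fintype.card_fin] at h
  refine le_trans (le_of_eq (lintegral_congr fun ω => ?_)) h
  congr 2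
  rw [Submodule.starProjection_apply, ← Submodule.coe_norm, ← b.sum_sq_norm_inner_right]
  refine Finset.sum_congr rfl fun j _ => ?_
  rw [Real.norm_eq_abs, sq_abs, ← Submodule.inner_orthogonalProjectionOnto_eq_of_mem_left]

/-- The deterministic part of the oracle inequality: a penalized least squares fit `x` is compared
with a competitor `y`, where `V` contains `x - y`. -/
lemma norm_sq_sub_le_of_penalized {E : Type*} [NormedAddCommGroup E] [InnerProductSpace ℝ E]
    (V : Submodule ℝ E) [V.HasOrthogonalProjection] {a s x y : E} {p q : ℝ} (hV : x - y ∈ V)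
    (h : ‖a - x‖ ^ 2 + q ≤ ‖a - y‖ ^ 2 + p) :
    ‖x - s‖ ^ 2 ≤ 3 * ‖y - s‖ ^ 2 + 2 * p - 2 * q + 8 * ‖V.starProjection (a - s)‖ ^ 2 := by
  have h1 : ‖a - x‖ ^ 2 = ‖a - s‖ ^ 2 - 2 * inner ℝ (a - s) (x - s) + ‖x - s‖ ^ 2 := by
    rw [← norm_sub_sq_real, sub_sub_sub_cancel_right]
  have h2 : ‖a - y‖ ^ 2 = ‖a - s‖ ^ 2 - 2 * inner ℝ (a - s) (y - s) + ‖y - s‖ ^ 2 := by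
    rw [← norm_sub_sq_real, sub_sub_sub_cancel_right]
  have h3 : inner ℝ (a - s) (x - y) = inner ℝ (a - s) (x - s) - inner ℝ (a - s) (y - s) := by
    rw [← inner_sub_right, sub_sub_sub_cancel_right]
  have h4 : inner ℝ (a - s) (x - y) ≤ ‖V.starProjection (a - s)‖ * ‖x - y‖ := by
    have : inner ℝ (a - s) (x - y) = inner ℝ (V.starProjection (a - s)) (x - y) := by
      rw [Submodule.inner_starProjection_left_eq_right, Submodule.starProjection_eq_self_iff.mpr hV]
    rw [this]
    exact real_inner_le_norm _ _
  have h5 : ‖x - y‖ ≤ ‖x - s‖ + ‖y - s‖ := by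
    rw [← sub_sub_sub_cancel_right x y s]
    exact norm_sub_le _ _
  have h6 := norm_nonneg (x - y)
  -- `2 ‖Pξ‖ ‖x - y‖ ≤ 4 ‖Pξ‖² + ‖x - y‖² / 4`, and `‖x - y‖² ≤ 2 ‖x - s‖² + 2 ‖y - s‖²`; half of
  -- `‖x - s‖²` is absorbed on the left, then everything is doubled.
  nlinarith [sq_nonneg (4 * ‖V.starProjection (a - s)‖ - ‖x - y‖),
    sq_nonneg (‖x - s‖ - ‖y - s‖), pow_le_pow_left₀ h6 h5 2]

/-! ### Counting clusterings and comparing the penalties -/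

lemma choose_le_mul_exp_div_pow (n k : ℕ) :
    (n.choose k : ℝ) ≤ ((n : ℝ) * Real.exp 1 / k) ^ k := by
  rcases Nat.eq_zero_or_pos k with rfl | hk
  · simp
  have hk' : (0 : ℝ) < k := by exact_mod_cast hk
  have h1 : (k : ℝ) ^ k / k.factorial ≤ Real.exp 1 ^ k := by
    rw [← Real.exp_nat_mul, mul_one]
    exact Real.pow_div_factorial_le_exp _ hk'.le k
  have hf : (0 : ℝ) < k.factorial := by exact_mod_cast k.factorial_pos
  calc (n.choose k : ℝ) ≤ (n : ℝ) ^ k / k.factorial := Nat.choose_le_pow_div k n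
    _ = (n / k : ℝ) ^ k * ((k : ℝ) ^ k / k.factorial) := by
        rw [div_pow]; field_simp
    _ ≤ (n / k : ℝ) ^ k * Real.exp 1 ^ k := by gcongr
    _ = _ := by rw [← mul_pow]; congr 1; ring

/-- Enlarge the set of changed nodes to a set of exactly `n₀` nodes, which needs `n₀ ≤ n`. The new
labels are free on it and forced elsewhere. -/
lemma card_filter_card_ne_le (m n n₀ : ℕ) (hn₀ : n₀ ≤ n) (x : Fin n → Fin m) :
    (Finset.univ.filter fun y : Fin n → Fin m =>
      (Finset.univ.filter fun i => x i ≠ y i).card ≤ n₀).card ≤ n.choose n₀ * m ^ n₀ := by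
  classical
  have hsub : (Finset.univ.filter fun y : Fin n → Fin m =>
      (Finset.univ.filter fun i => x i ≠ y i).card ≤ n₀) ⊆
      (Finset.powersetCard n₀ (Finset.univ : Finset (Fin n))).biUnion fun S =>
        Fintype.piFinset fun i => if i ∈ S then Finset.univ else {x i} := by
    intro y hy
    simp only [Finset.mem_filter, Finset.mem_univ, true_and] at hy
    obtain ⟨S, hS, hcard⟩ := Finset.exists_superset_card_eq hy (by simpa using hn₀)
    simp only [Finset.mem_biUnion, Finset.mem_powersetCard, Fintype.mem_piFinset]
    refine ⟨S, ⟨Finset.subset_univ _, hcard⟩, fun i => ?_⟩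
    split_ifs with hi
    · simp
    · by_contra hne
      refine hi (hS ?_)
      simp only [Finset.mem_singleton] at hne
      simpa using fun h => hne h.symm
  refine (Finset.card_le_card hsub).trans ?_
  refine (Finset.card_biUnion_le_card_mul _ _ (m ^ n₀) ?_).trans (by simp)
  intro S hS
  have hS' := (Finset.mem_powersetCard.mp hS).2
  rw [Fintype.card_piFinset]
  simp only [apply_ite Finset.card, Finset.card_univ, Fintype.card_fin, Finset.card_singleton]
  rw [Finset.prod_ite]
  simp [hS']

/-- Induction by forgetting the last time: a fibre of the restriction is determined by the last
labelling, which differs from the preceding one at no more than `n₀` nodes. -/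
lemma ncard_limitedChange_succ_le (m n n₀ L : ℕ) (hn₀ : n₀ ≤ n) :
    (limitedChange m n n₀ (L + 1)).ncard ≤ m ^ n * (n.choose n₀ * m ^ n₀) ^ L := by
  classical
  induction L with
  | zero =>
    refine (Set.ncard_le_card _).trans ?_
    simp
  | succ L ih =>
    rw [Set.ncard_eq_toFinset_card'] at ih ⊢
    have hmaps : ∀ z ∈ (limitedChange m n n₀ (L + 1 + 1)).toFinset,
        (fun l : Fin (L + 1) => z l.castSucc) ∈ (limitedChange m n n₀ (L + 1)).toFinset := by
      intro z hz
      rw [Set.mem_toFinset] at hz ⊢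
      exact fun l l' h => hz l.castSucc l'.castSucc (by simpa using h)
    refine (Finset.card_le_mul_card_image_of_maps_to hmaps (n.choose n₀ * m ^ n₀) ?_).trans ?_
    · intro w _
      refine le_trans ?_ (card_filter_card_ne_le m n n₀ hn₀ (w (Fin.last L)))
      refine Finset.card_le_card_of_injOn (fun z => z (Fin.last (L + 1))) ?_ ?_
      · intro z hz
        simp only [Finset.coe_filter, Set.mem_toFinset, Set.mem_ofPred_eq] at hz
        obtain ⟨hz, rfl⟩ := hz
        simp only [Finset.coe_filter, Finset.mem_univ, true_and, Set.mem_ofPred_eq]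
        exact hz (Fin.last L).castSucc (Fin.last (L + 1)) (by simp)
      · intro z hz z' hz' h
        simp only [Finset.coe_filter, Set.mem_toFinset, Set.mem_ofPred_eq] at hz hz'
        funext l
        refine Fin.lastCases h (fun l => ?_) l
        exact congrFun (hz.2.trans hz'.2.symm) l
    · calc _ ≤ (n.choose n₀ * m ^ n₀) * (m ^ n * (n.choose n₀ * m ^ n₀) ^ L) := by gcongr
        _ = _ := by ring

/-- Clusterings that are constant in time already suffice. -/
lemma pow_le_ncard_limitedChange (m n n₀ L : ℕ) (hL : 1 ≤ L) :
    m ^ n ≤ (limitedChange m n n₀ L).ncard := by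
  have hinj : Function.Injective fun (x : Fin n → Fin m) (_ : Fin L) => x :=
    fun x y h => congrFun h ⟨0, hL⟩
  have h1 : (Set.range fun (x : Fin n → Fin m) (_ : Fin L) => x).ncard = m ^ n := by
    rw [← Set.image_univ, Set.ncard_image_of_injective _ hinj, Set.ncard_univ]
    simp
  rw [← h1]
  refine Set.ncard_le_ncard ?_ (Set.toFinite _)
  rintro _ ⟨x, rfl⟩ l l' _
  simp

lemma one_le_ncard_limitedChange {m n n₀ L : ℕ} (hL : 1 ≤ L) (hm : 1 ≤ m) :
    1 ≤ (limitedChange m n n₀ L).ncard :=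
  (Nat.one_le_pow _ _ hm).trans (pow_le_ncard_limitedChange m n n₀ L hL)

lemma log_ncard_limitedChange_le {m n n₀ L : ℕ} (hL : 1 ≤ L) (hm : 1 ≤ m) (hn₀ : n₀ ≤ n) :
    Real.log ((limitedChange m n n₀ L).ncard : ℝ) ≤ (n : ℝ) * Real.log (m : ℝ)
      + (n₀ : ℝ) * ((L : ℝ) - 1) * Real.log ((m : ℝ) * (n : ℝ) * Real.exp 1 / (n₀ : ℝ)) := by
  obtain ⟨K, rfl⟩ : ∃ K, L = K + 1 := ⟨L - 1, by omega⟩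
  have hm' : (0 : ℝ) < m := by exact_mod_cast hm
  -- For `n₀ = 0` the base is a division by zero, but the power is `x ^ 0 = 1`.
  have hbase : (0 : ℝ) < ((m : ℝ) * n * Real.exp 1 / n₀) ^ n₀ := by
    rcases Nat.eq_zero_or_pos n₀ with rfl | h
    · simp
    · have h1 : (0 : ℝ) < n₀ := by exact_mod_cast h
      have h2 : (0 : ℝ) < n := by exact_mod_cast h.trans_le hn₀
      positivity
  have h1 : (((limitedChange m n n₀ (K + 1)).ncard : ℕ) : ℝ) ≤
      (m : ℝ) ^ n * (((m : ℝ) * n * Real.exp 1 / n₀) ^ n₀) ^ K := by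
    have h := ncard_limitedChange_succ_le m n n₀ K hn₀
    have h' : (((limitedChange m n n₀ (K + 1)).ncard : ℕ) : ℝ) ≤
        (m : ℝ) ^ n * ((n.choose n₀ : ℝ) * (m : ℝ) ^ n₀) ^ K := by exact_mod_cast h
    refine h'.trans ?_
    gcongr
    calc (n.choose n₀ : ℝ) * (m : ℝ) ^ n₀ ≤ ((n : ℝ) * Real.exp 1 / n₀) ^ n₀ * (m : ℝ) ^ n₀ := by
          gcongr
          exact choose_le_mul_exp_div_pow n n₀
      _ = _ := by rw [← mul_pow]; congr 1; ring
  have hpos : (0 : ℝ) < ((limitedChange m n n₀ (K + 1)).ncard : ℕ) := by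
    exact_mod_cast one_le_ncard_limitedChange (n := n) (n₀ := n₀) hL hm
  refine (Real.log_le_log hpos h1).trans (le_of_eq ?_)
  rw [Real.log_mul (by positivity) (by positivity), Real.log_pow, Real.log_pow, Real.log_pow]
  push_cast
  ring

lemma cardPenalty_le_explicitPenalty {m n n₀ L : ℕ} (hL : 1 ≤ L) (hm : 1 ≤ m) (hn₀ : n₀ ≤ n)
    (k : ℕ) : cardPenalty n n₀ L m k ≤ explicitPenalty n n₀ L m k := by
  have := log_ncard_limitedChange_le hL hm hn₀
  unfold cardPenalty explicitPenalty
  linarith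

/-! ### Summability of the exponential weights -/

lemma card_index_le (m L : ℕ) : Fintype.card (Fin L × ClassPair m) ≤ m ^ 2 * L := by
  rw [Fintype.card_prod, Sym2.card, Fintype.card_fin, Fintype.card_fin, mul_comm]
  refine Nat.mul_le_mul_right _ ?_
  rw [Nat.choose_two_right]
  refine Nat.div_le_of_le_mul ?_
  rcases m with _ | m
  · simp
  · simp only [Nat.add_sub_cancel]
    nlinarith

lemma mul_log_div_le {a k : ℝ} (hk : 0 ≤ k) (hka : k ≤ a) :
    0 ≤ k * Real.log (25 * a / k) := by
  rcases hk.eq_or_lt with rfl | h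
  · simp
  · refine mul_nonneg hk (Real.log_nonneg ?_)
    rw [le_div_iff₀ h]
    linarith

lemma cardPenalty_nonneg {m n n₀ L : ℕ} {k : ℕ} (hk : k ≤ m ^ 2 * L) :
    0 ≤ cardPenalty n n₀ L m k := by
  have h1 : (0 : ℝ) ≤ Real.log ((limitedChange m n n₀ L).ncard : ℝ) :=
    Real.log_natCast_nonneg _
  have hk' : (k : ℝ) ≤ (m : ℝ) ^ 2 * L := by exact_mod_cast hk
  have h2 := mul_log_div_le (Nat.cast_nonneg k) hk'
  rw [← mul_assoc] at h2
  unfold cardPenalty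
  linarith

/-- `exp (- Pen / 4) ≤ |𝒵|⁻² (k / (25 m² L))ᵏ`. -/
lemma exp_neg_cardPenalty_le {m n n₀ L : ℕ} (hL : 1 ≤ L) (hm : 1 ≤ m) {k : ℕ}
    (hk : k ≤ m ^ 2 * L) :
    Real.exp (-(cardPenalty n n₀ L m k / 4)) ≤
      (((limitedChange m n n₀ L).ncard : ℝ) ^ 2)⁻¹ *
        ((k : ℝ) / (25 * ((m : ℝ) ^ 2 * L))) ^ k := by
  set Z : ℝ := ((limitedChange m n n₀ L).ncard : ℝ) with hZdef
  have hZ : (1 : ℝ) ≤ Z := by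
    rw [hZdef]
    exact_mod_cast one_le_ncard_limitedChange (n := n) (n₀ := n₀) hL hm
  have hm' : (0 : ℝ) < m := by exact_mod_cast hm
  have hL' : (0 : ℝ) < L := by exact_mod_cast hL
  have hk' : (k : ℝ) ≤ (m : ℝ) ^ 2 * L := by exact_mod_cast hk
  have h2 := mul_log_div_le (Nat.cast_nonneg k) hk'
  have hlog := Real.log_nonneg hZ
  have hrhs : (Z ^ 2)⁻¹ * ((k : ℝ) / (25 * ((m : ℝ) ^ 2 * L))) ^ k =
      Real.exp (-(2 * Real.log Z + k * Real.log (25 * ((m : ℝ) ^ 2 * L) / k))) := by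
    have hpos : (0 : ℝ) < ((k : ℝ) / (25 * ((m : ℝ) ^ 2 * L))) ^ k := by
      rcases Nat.eq_zero_or_pos k with rfl | h
      · simp
      · have : (0 : ℝ) < k := by exact_mod_cast h
        positivity
    rw [← Real.exp_log (mul_pos (by positivity) hpos), Real.log_mul (by positivity) hpos.ne',
      Real.log_inv, Real.log_pow, Real.log_pow, ← inv_div, Real.log_inv]
    congr 1
    push_cast
    ring
  rw [hrhs]
  -- Both logarithmic terms are nonnegative, so the coefficients `11/4` and `11/8` may be lowered to
  -- `2` and `1`.
  refine Real.exp_le_exp.mpr ?_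
  unfold cardPenalty
  rw [← hZdef]
  have h3 : 25 * (m : ℝ) ^ 2 * (L : ℝ) / (k : ℝ) = 25 * ((m : ℝ) ^ 2 * L) / k := by ring
  rw [h3]
  linarith

lemma exp_one_mul_sqrt_two_le : Real.exp 1 * √2 / 25 ≤ 1 / 4 := by
  have h1 := Real.exp_one_lt_d9
  have h2 : √2 ≤ 3 / 2 := by
    rw [Real.sqrt_le_left (by norm_num)]
    norm_num
  have := mul_le_mul h1.le h2 (Real.sqrt_nonneg 2) (by norm_num)
  linarith

/-- Group the subsets by cardinality `k`. The bound `(K e / k) ^ k` on their number cancels `k ^ k`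
in the weight, leaving `(e √2 / 25) ^ k ≤ (1/4) ^ k`: the constant `25` makes the series geometric.
Its sum `4/3` times `√2 ≤ 3/2` gives the factor `2`. -/
lemma sum_subsets_exp_neg_cardPenalty_le {m n n₀ L : ℕ} (hL : 1 ≤ L) (hm : 1 ≤ m) :
    ∑ J : Finset (Fin L × ClassPair m),
      Real.exp (-(cardPenalty n n₀ L m J.card / 4)) * √2 ^ (J.card + 1) ≤
      2 * (((limitedChange m n n₀ L).ncard : ℝ) ^ 2)⁻¹ := by
  set Z : ℝ := ((limitedChange m n n₀ L).ncard : ℝ) with hZdef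
  set K := Fintype.card (Fin L × ClassPair m) with hKdef
  have hK : K ≤ m ^ 2 * L := card_index_le m L
  have hK' : (K : ℝ) ≤ (m : ℝ) ^ 2 * L := by exact_mod_cast hK
  have hm' : (0 : ℝ) < m := by exact_mod_cast hm
  have hL' : (0 : ℝ) < L := by exact_mod_cast hL
  have hterm : ∀ k ∈ Finset.range (K + 1),
      K.choose k • (Real.exp (-(cardPenalty n n₀ L m k / 4)) * √2 ^ (k + 1)) ≤
        (Z ^ 2)⁻¹ * √2 * (1 / 4) ^ k := by
    intro k hk
    have hkK : k ≤ K := Nat.lt_succ_iff.mp (Finset.mem_range.mp hk)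
    have h1 := exp_neg_cardPenalty_le (n := n) (n₀ := n₀) hL hm (hkK.trans hK)
    rw [← hZdef] at h1
    have h2 : (K.choose k : ℝ) * ((k : ℝ) / (25 * ((m : ℝ) ^ 2 * L))) ^ k ≤
        (Real.exp 1 / 25) ^ k := by
      rcases Nat.eq_zero_or_pos k with rfl | hk0
      · simp
      have hk0' : (0 : ℝ) < k := by exact_mod_cast hk0
      calc (K.choose k : ℝ) * ((k : ℝ) / (25 * ((m : ℝ) ^ 2 * L))) ^ k
          ≤ ((K : ℝ) * Real.exp 1 / k) ^ k * ((k : ℝ) / (25 * ((m : ℝ) ^ 2 * L))) ^ k := by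
            gcongr
            exact choose_le_mul_exp_div_pow K k
        _ ≤ (((m : ℝ) ^ 2 * L) * Real.exp 1 / k) ^ k *
              ((k : ℝ) / (25 * ((m : ℝ) ^ 2 * L))) ^ k := by gcongr
        _ = (Real.exp 1 / 25) ^ k := by
            rw [← mul_pow]
            congr 1
            field_simp
    rw [nsmul_eq_mul]
    calc (K.choose k : ℝ) * (Real.exp (-(cardPenalty n n₀ L m k / 4)) * √2 ^ (k + 1))
        ≤ (K.choose k : ℝ) * (((Z ^ 2)⁻¹ * ((k : ℝ) / (25 * ((m : ℝ) ^ 2 * L))) ^ k)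
            * √2 ^ (k + 1)) := by gcongr
      _ = (Z ^ 2)⁻¹ * √2 * (((K.choose k : ℝ) * ((k : ℝ) / (25 * ((m : ℝ) ^ 2 * L))) ^ k)
            * √2 ^ k) := by ring
      _ ≤ (Z ^ 2)⁻¹ * √2 * ((Real.exp 1 / 25) ^ k * √2 ^ k) := by gcongr
      _ = (Z ^ 2)⁻¹ * √2 * (Real.exp 1 * √2 / 25) ^ k := by
          rw [← mul_pow]; congr 2; ring
      _ ≤ (Z ^ 2)⁻¹ * √2 * (1 / 4) ^ k := by
          have := pow_le_pow_left₀ (by positivity) exp_one_mul_sqrt_two_le k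
          gcongr ?_ * ?_
  rw [← Finset.powerset_univ, Finset.sum_powerset_apply_card
    (fun k => Real.exp (-(cardPenalty n n₀ L m k / 4)) * √2 ^ (k + 1)), Finset.card_univ, ← hKdef]
  refine (Finset.sum_le_sum hterm).trans ?_
  rw [← Finset.mul_sum]
  have hgeom : ∑ k ∈ Finset.range (K + 1), (1 / 4 : ℝ) ^ k ≤ 4 / 3 := by
    have := (summable_geometric_of_lt_one (r := (1 / 4 : ℝ)) (by norm_num)
      (by norm_num)).sum_le_tsum (Finset.range (K + 1)) (fun _ _ => by positivity)
    rw [tsum_geometric_of_lt_one (by norm_num) (by norm_num)] at this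
    linarith
  have hsqrt : √2 ≤ 3 / 2 := by
    rw [Real.sqrt_le_left (by norm_num)]
    norm_num
  calc (Z ^ 2)⁻¹ * √2 * ∑ k ∈ Finset.range (K + 1), (1 / 4 : ℝ) ^ k
      ≤ (Z ^ 2)⁻¹ * (3 / 2) * (4 / 3) := by gcongr
    _ = 2 * (Z ^ 2)⁻¹ := by ring

/-- The term `m = 1` is one; each of the other `n - 1` terms is at most `2 ^ (-n)`. -/
lemma sum_inv_pow_self_le (n : ℕ) (hn : 1 ≤ n) :
    ∑ m ∈ Finset.Icc 1 n, ((m : ℝ) ^ n)⁻¹ ≤ 2 := by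
  rw [← Finset.add_sum_Ioc_eq_sum_Icc hn]
  have h1 : ∀ m ∈ Finset.Ioc 1 n, ((m : ℝ) ^ n)⁻¹ ≤ ((2 : ℝ) ^ n)⁻¹ := by
    intro m hm
    have : (2 : ℝ) ≤ m := by exact_mod_cast (Finset.mem_Ioc.mp hm).1
    gcongr
  have h2 := Finset.sum_le_card_nsmul _ _ _ h1
  rw [Nat.card_Ioc, nsmul_eq_mul] at h2
  have h3 : ((n - 1 : ℕ) : ℝ) * ((2 : ℝ) ^ n)⁻¹ ≤ 1 := by
    rw [← div_eq_mul_inv, div_le_one (by positivity)]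
    exact_mod_cast (Nat.sub_le n 1).trans n.lt_two_pow_self.le
  simp only [Nat.cast_one, one_pow, inv_one]
  linarith

open Classical in
-- One of the two factors `|𝒵|⁻¹` pays for the number of clusterings; the other is at most `m ^
-- (-n)` and controls the sum over `m`.
lemma sum_exp_neg_penalty_le {n n₀ L : ℕ} (hn : 1 ≤ n) (hL : 1 ≤ L) {pen : ℕ → ℕ → ℝ}
    (hpen : ∀ m k, 1 ≤ m → cardPenalty n n₀ L m k ≤ pen m k) :
    ∑ m ∈ Finset.Icc 1 n, ∑ _z ∈ (limitedChange m n n₀ L).toFinset,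
      ∑ J : Finset (Fin L × ClassPair m),
        Real.exp (-(pen m J.card / 4)) * √2 ^ (J.card + 1) ≤ 4 := by
  have h : ∀ m ∈ Finset.Icc 1 n, ∑ _z ∈ (limitedChange m n n₀ L).toFinset,
      ∑ J : Finset (Fin L × ClassPair m),
        Real.exp (-(pen m J.card / 4)) * √2 ^ (J.card + 1) ≤ 2 * ((m : ℝ) ^ n)⁻¹ := by
    intro m hm
    have hm1 := (Finset.mem_Icc.mp hm).1
    have hm' : (0 : ℝ) < m := by exact_mod_cast hm1
    rw [Finset.sum_const, ← Set.ncard_eq_toFinset_card', nsmul_eq_mul]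
    have hle : ∑ J : Finset (Fin L × ClassPair m),
        Real.exp (-(pen m J.card / 4)) * √2 ^ (J.card + 1) ≤
        2 * (((limitedChange m n n₀ L).ncard : ℝ) ^ 2)⁻¹ := by
      refine le_trans (Finset.sum_le_sum fun J _ => ?_)
        (sum_subsets_exp_neg_cardPenalty_le (n := n) (n₀ := n₀) hL hm1)
      have := hpen m J.card hm1
      gcongr
    have hZ : (m : ℝ) ^ n ≤ ((limitedChange m n n₀ L).ncard : ℝ) := by
      exact_mod_cast pow_le_ncard_limitedChange m n n₀ L hL
    have hm2 : (0 : ℝ) < (m : ℝ) ^ n := by positivity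
    have hZ0 := hm2.trans_le hZ
    calc _ ≤ ((limitedChange m n n₀ L).ncard : ℝ) *
          (2 * (((limitedChange m n n₀ L).ncard : ℝ) ^ 2)⁻¹) := by gcongr
      _ = 2 * ((limitedChange m n n₀ L).ncard : ℝ)⁻¹ := by field_simp
      _ ≤ 2 * ((m : ℝ) ^ n)⁻¹ := by gcongr
  refine (Finset.sum_le_sum h).trans ?_
  rw [← Finset.mul_sum]
  linarith [sum_inv_pow_self_le n hn]

/-! ### The noise of a network -/

section Network

variable {Ω : Type*} [MeasurableSpace Ω] {μ : Measure Ω} {n L : ℕ} {B : Ω → Tensor n L}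
  {Λ : Tensor n L}

lemma IsNetwork.measurable_vectorize (hB : IsNetwork μ B Λ) (p : Fin L × NodePair n) :
    Measurable fun ω => vectorize (B ω) p :=
  hB.measurable _ _ _

lemma IsNetwork.integral_vectorize (hB : IsNetwork μ B Λ) (p : Fin L × NodePair n) :
    ∫ ω, vectorize (B ω) p ∂μ = vectorize Λ p := by
  have h : (fun ω => vectorize (B ω) p) =
      Set.indicator {ω | B ω p.2.1.1 p.2.1.2 p.1 = 1} 1 := by
    funext ω
    rcases hB.binary ω p.2.1.1 p.2.1.2 p.1 with h | h <;> simp [vectorize, Set.indicator, h]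
  have hmeas : MeasurableSet {ω | B ω p.2.1.1 p.2.1.2 p.1 = 1} :=
    hB.measurable _ _ _ (measurableSet_singleton 1)
  rw [h, integral_indicator_one hmeas, hB.prob _ _ _ p.2.2, vectorize]

/-- Hoeffding's lemma gives each centred entry the variance proxy `1/4`, and proxies of independent
summands add. -/
lemma IsNetwork.lintegral_exp_inner_le [IsProbabilityMeasure μ] (hB : IsNetwork μ B Λ)
    (v : EuclideanSpace ℝ (Fin L × NodePair n)) :
    ∫⁻ ω, ENNReal.ofReal (Real.exp
        (inner ℝ v (WithLp.toLp 2 (vectorize (B ω) - vectorize Λ)))) ∂μ ≤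
      ENNReal.ofReal (Real.exp (‖v‖ ^ 2 / 8)) := by
  have hsub : ∀ p : Fin L × NodePair n, HasSubgaussianMGF
      (fun ω => v p * (vectorize (B ω) p - vectorize Λ p))
      (Real.toNNReal (v p ^ 2 / 4)) μ := by
    intro p
    have h := hasSubgaussianMGF_of_mem_Icc (μ := μ) (a := 0) (b := 1)
      (hB.measurable_vectorize p).aemeasurable (Filter.Eventually.of_forall fun ω => by
        rcases hB.binary ω p.2.1.1 p.2.1.2 p.1 with h | h <;> simp [vectorize, h])
    rw [hB.integral_vectorize p] at h
    convert h.const_mul (v p) using 1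
    refine NNReal.eq ?_
    rw [Real.coe_toNNReal _ (by positivity)]
    change v p ^ 2 / 4 = v p ^ 2 * (((‖(1 : ℝ) - 0‖₊ / 2) ^ 2 : NNReal) : ℝ)
    rw [NNReal.coe_pow, NNReal.coe_div, coe_nnnorm, sub_zero, norm_one]
    push_cast
    ring
  have hind : iIndepFun (fun p ω => v p * (vectorize (B ω) p - vectorize Λ p)) μ :=
    hB.indep.comp (fun p x => v p * (x - vectorize Λ p)) fun p => by fun_prop
  have hsum := HasSubgaussianMGF.sum_of_iIndepFun hind (s := Finset.univ) fun p _ => hsub p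
  have hle := hsum.mgf_le 1
  have hint := hsum.integrable_exp_mul 1
  simp only [mgf, one_mul] at hle hint
  have hinner : ∀ ω, inner ℝ v (WithLp.toLp 2 (vectorize (B ω) - vectorize Λ)) =
      ∑ p, v p * (vectorize (B ω) p - vectorize Λ p) := by
    intro ω
    simp [PiLp.inner_apply, mul_comm]
  simp_rw [hinner]
  rw [← ofReal_integral_eq_lintegral_ofReal hint
    (Filter.Eventually.of_forall fun _ => (Real.exp_pos _).le)]
  refine ENNReal.ofReal_le_ofReal (hle.trans (le_of_eq ?_))
  congr 1
  rw [EuclideanSpace.norm_sq_eq]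
  rw [NNReal.coe_sum, one_pow, mul_one, Finset.sum_div, Finset.sum_div]
  refine Finset.sum_congr rfl fun p _ => ?_
  rw [Real.coe_toNNReal _ (by positivity), Real.norm_eq_abs, sq_abs]
  ring

/-- A network takes finitely many values, so every function of it is bounded and measurable. -/
lemma IsNetwork.integrable_comp [IsFiniteMeasure μ] (hB : IsNetwork μ B Λ)
    (F : (Fin L × NodePair n → ℝ) → ℝ) : Integrable (fun ω => F (vectorize (B ω))) μ := by
  classical
  let b : Ω → (Fin L × NodePair n → Bool) := fun ω p => decide (vectorize (B ω) p = 1)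
  have hb : Measurable b := by
    refine measurable_pi_lambda _ fun p => ?_
    refine measurable_to_bool ?_
    have : (fun ω => b ω p) ⁻¹' {true} = (fun ω => vectorize (B ω) p) ⁻¹' {1} := by
      ext ω
      simp [b]
    rw [this]
    exact hB.measurable_vectorize p (measurableSet_singleton 1)
  let G : (Fin L × NodePair n → Bool) → ℝ := fun c => F fun p => if c p then 1 else 0
  have hG : (fun ω => F (vectorize (B ω))) = G ∘ b := by
    funext ω
    simp only [G, b, Function.comp_apply]
    congr 1
    funext p
    rcases hB.binary ω p.2.1.1 p.2.1.2 p.1 with h | h <;> simp [vectorize, h]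
  rw [hG]
  have hfin : ∃ C, ∀ c, ‖G c‖ ≤ C := by
    obtain ⟨C, hC⟩ := (Set.finite_range fun c => ‖G c‖).bddAbove
    exact ⟨C, fun c => hC ⟨c, rfl⟩⟩
  obtain ⟨C, hC⟩ := hfin
  exact Integrable.of_bound ((measurable_of_finite G).comp hb).aestronglyMeasurable C
    (Filter.Eventually.of_forall fun ω => hC (b ω))

lemma IsNetwork.integral_exp_norm_starProjection_sq_le [IsProbabilityMeasure μ]
    (hB : IsNetwork μ B Λ) (V : Submodule ℝ (EuclideanSpace ℝ (Fin L × NodePair n))) :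
    ∫ ω, Real.exp (‖V.starProjection (WithLp.toLp 2 (vectorize (B ω) - vectorize Λ))‖ ^ 2) ∂μ ≤
      √2 ^ Module.finrank ℝ V := by
  have hmeas : Measurable fun ω =>
      (WithLp.toLp 2 (vectorize (B ω) - vectorize Λ) : EuclideanSpace ℝ (Fin L × NodePair n)) := by
    refine (WithLp.measurable_toLp 2 _).comp (measurable_pi_lambda _ fun p => ?_)
    exact (hB.measurable_vectorize p).sub measurable_const
  have h := lintegral_exp_norm_starProjection_sq_le hmeas hB.lintegral_exp_inner_le V
  rw [← ofReal_integral_eq_lintegral_ofReal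
    (hB.integrable_comp fun a => Real.exp (‖V.starProjection (WithLp.toLp 2 (a - vectorize Λ))‖ ^ 2))
    (Filter.Eventually.of_forall fun _ => (Real.exp_pos _).le)] at h
  exact (ENNReal.ofReal_le_ofReal_iff (by positivity)).mp h

end Network

/-! ### Tensors and vectors -/

lemma sqNorm_eq_norm_sq {ι : Type*} [Fintype ι] (v : ι → ℝ) :
    sqNorm v = ‖(WithLp.toLp 2 v : EuclideanSpace ℝ ι)‖ ^ 2 := by
  simp [sqNorm, EuclideanSpace.norm_sq_eq]

lemma Tensor.sqNorm_eq_two_mul {n L : ℕ} (T : Tensor n L) (hsymm : ∀ i j l, T i j l = T j i l)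
    (hdiag : ∀ i l, T i i l = 0) : Tensor.sqNorm T = 2 * DSBM.sqNorm (vectorize T) := by
  have h1 : DSBM.sqNorm (vectorize T) = ∑ l, ∑ i, ∑ j, if i < j then T i j l ^ 2 else 0 := by
    unfold DSBM.sqNorm vectorize
    rw [Fintype.sum_prod_type]
    refine Finset.sum_congr rfl fun l _ => ?_
    rw [← Fintype.sum_prod_type' (f := fun i j : Fin n => if i < j then T i j l ^ 2 else 0),
      ← Finset.sum_filter]
    exact (Finset.sum_subtype _ (by simp) fun p : Fin n × Fin n => T p.1 p.2 l ^ 2).symm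
  have h2 : ∀ l, ∑ i, ∑ j, (if i < j then T i j l ^ 2 else 0) =
      ∑ i, ∑ j, if j < i then T i j l ^ 2 else 0 := by
    intro l
    rw [Finset.sum_comm]
    simp_rw [hsymm]
  rw [two_mul]
  nth_rewrite 2 [h1]
  simp_rw [h2]
  rw [h1]
  unfold Tensor.sqNorm
  simp_rw [← Finset.sum_add_distrib]
  refine Finset.sum_congr rfl fun l _ => Finset.sum_congr rfl fun i _ =>
    Finset.sum_congr rfl fun j _ => ?_
  rcases lt_trichotomy i j with h | rfl | h
  · simp [h, h.not_gt]
  · simp [hdiag]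
  · simp [h, h.not_gt]

/-- Each pair of nodes occurs twice in the tensor; this doubling turns the constants `3, 2, 8` of
the deterministic bound into `6, 4, 16`. -/
lemma sqNorm_pack_sub {n L : ℕ} (θ : Fin L × NodePair n → ℝ) {Λ : Tensor n L}
    (hΛ : IsBlockTensor Λ) :
    Tensor.sqNorm (pack θ - Λ) = 2 * sqNorm (θ - vectorize Λ) := by
  obtain ⟨m, z, G, hG, -, hΛ⟩ := hΛ
  rw [Tensor.sqNorm_eq_two_mul]
  · congr 2
    funext p
    simp [vectorize, pack, p.2.2]
  · intro i j l
    simp only [Pi.sub_apply, hΛ, pack]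
    rcases lt_trichotomy i j with h | rfl | h
    · simp [h, h.not_gt, h.ne, h.ne', hG (z l i)]
    · simp
    · simp [h, h.not_gt, h.ne, h.ne', hG (z l i)]
  · intro i l
    simp [hΛ, pack]

/-! ### The oracle inequality -/

/-- The span of `y` and of the columns with indices in `J` of `C Wᵀ`. -/
def fitSpace {m n L : ℕ} (H : Matrix (Fin L) (Fin L) ℝ) (z : Clustering m n L)
    (J : Finset (Fin L × ClassPair m)) (y : Fin L × NodePair n → ℝ) :
    Submodule ℝ (EuclideanSpace ℝ (Fin L × NodePair n)) :=
  Submodule.span ℝ (insert (WithLp.toLp 2 y)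
    ((fun j => WithLp.toLp 2 ((clusterMatrix z * (transformMatrix H m).transpose).col j)) '' J))

lemma finrank_fitSpace_le {m n L : ℕ} (H : Matrix (Fin L) (Fin L) ℝ) (z : Clustering m n L)
    (J : Finset (Fin L × ClassPair m)) (y : Fin L × NodePair n → ℝ) :
    Module.finrank ℝ (fitSpace H z J y) ≤ J.card + 1 := by
  classical
  have h := finrank_span_finset_le_card (R := ℝ) (insert
    (WithLp.toLp 2 y : EuclideanSpace ℝ (Fin L × NodePair n))
    (J.image fun j => WithLp.toLp 2 ((clusterMatrix z * (transformMatrix H m).transpose).col j)))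
  rw [Finset.coe_insert, Finset.coe_image] at h
  exact h.trans ((Finset.card_insert_le _ _).trans (Nat.add_le_add_right Finset.card_image_le 1))

lemma sub_mem_fitSpace {m n L : ℕ} (H : Matrix (Fin L) (Fin L) ℝ) (z : Clustering m n L)
    (J : Finset (Fin L × ClassPair m)) (y : Fin L × NodePair n → ℝ)
    (d : Fin L × ClassPair m → ℝ) (hd : ∀ j, j ∉ J → d j = 0) :
    (WithLp.toLp 2 (fittedVector H z d) : EuclideanSpace ℝ (Fin L × NodePair n)) - WithLp.toLp 2 y
      ∈ fitSpace H z J y := by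
  refine Submodule.sub_mem _ ?_ (Submodule.subset_span (Set.mem_insert _ _))
  have : (WithLp.toLp 2 (fittedVector H z d) : EuclideanSpace ℝ (Fin L × NodePair n)) =
      ∑ j ∈ J, d j • WithLp.toLp 2 ((clusterMatrix z * (transformMatrix H m).transpose).col j) := by
    rw [Finset.sum_subset (Finset.subset_univ J) fun j _ hj => by rw [hd j hj, zero_smul]]
    ext p
    simp [fittedVector, Matrix.mulVec, dotProduct, mul_comm]
  rw [this]
  exact Submodule.sum_mem _ fun j hj => Submodule.smul_mem _ _
    (Submodule.subset_span (Set.mem_insert_of_mem _ (Set.mem_image_of_mem _ hj)))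

open Classical in
/-- The sum over all models of the exponentials of the penalized squared norms of the projected
noise. -/
def noiseSum {n L : ℕ} (n₀ : ℕ) (H : Matrix (Fin L) (Fin L) ℝ) (pen : ℕ → ℕ → ℝ)
    (Λ : Tensor n L) (y a : Fin L × NodePair n → ℝ) : ℝ :=
  ∑ m ∈ Finset.Icc 1 n, ∑ z ∈ (limitedChange m n n₀ L).toFinset,
    ∑ J : Finset (Fin L × ClassPair m),
      Real.exp (-(pen m J.card / 4)) *
        Real.exp (‖(fitSpace H z J y).starProjection (WithLp.toLp 2 (a - vectorize Λ))‖ ^ 2)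

lemma integral_noiseSum_le {Ω : Type*} [MeasurableSpace Ω] {μ : Measure Ω} [IsProbabilityMeasure μ]
    {n n₀ L : ℕ} (hn : 1 ≤ n) (hL : 1 ≤ L) (H : Matrix (Fin L) (Fin L) ℝ) {Λ : Tensor n L}
    {B : Ω → Tensor n L} (hB : IsNetwork μ B Λ) {pen : ℕ → ℕ → ℝ}
    (hpen : ∀ m k, 1 ≤ m → cardPenalty n n₀ L m k ≤ pen m k) (y : Fin L × NodePair n → ℝ) :
    ∫ ω, noiseSum n₀ H pen Λ y (vectorize (B ω)) ∂μ ≤ 4 := by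
  classical
  refine le_trans ?_ (sum_exp_neg_penalty_le hn hL hpen)
  have hint : ∀ (m : ℕ) (z : Clustering m n L) (J : Finset (Fin L × ClassPair m)),
      Integrable (fun ω => Real.exp (-(pen m J.card / 4)) * Real.exp
        (‖(fitSpace H z J y).starProjection
          (WithLp.toLp 2 (vectorize (B ω) - vectorize Λ))‖ ^ 2)) μ :=
    fun m z J => hB.integrable_comp fun a => Real.exp (-(pen m J.card / 4)) * Real.exp
      (‖(fitSpace H z J y).starProjection (WithLp.toLp 2 (a - vectorize Λ))‖ ^ 2)
  unfold noiseSum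
  rw [integral_finsetSum _ fun m _ => integrable_finsetSum _ fun z _ =>
    integrable_finsetSum _ fun J _ => hint m z J]
  refine Finset.sum_le_sum fun m _ => ?_
  rw [integral_finsetSum _ fun z _ => integrable_finsetSum _ fun J _ => hint m z J]
  have hone : (1 : ℝ) ≤ √2 := Real.one_le_sqrt.mpr (by norm_num)
  refine le_trans (Finset.sum_le_sum fun z _ => ?_) (le_of_eq (by congr))
  rw [integral_finsetSum _ fun J _ => hint m z J]
  refine Finset.sum_le_sum fun J _ => ?_
  rw [integral_const_mul]
  gcongr
  exact (hB.integral_exp_norm_starProjection_sq_le _).trans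
    (pow_le_pow_right₀ hone (finrank_fitSpace_le H z J y))

/-- The oracle inequality with a random remainder. -/
lemma sqNorm_tensor_sub_le {n n₀ L : ℕ} (hn : 1 ≤ n) (hL : 1 ≤ L)
    (H : Matrix (Fin L) (Fin L) ℝ) {Λ : Tensor n L} (hΛ : IsBlockTensor Λ) {pen : ℕ → ℕ → ℝ}
    (hpen : ∀ m k, 1 ≤ m → pen m k ≤ explicitPenalty n n₀ L m k)
    {a : Fin L × NodePair n → ℝ} {P : Params n L} (hP : IsSolution n₀ H pen a P)
    {m : ℕ} (hm : 1 ≤ m) (hmn : m ≤ n) {z : Clustering m n L} (hz : z ∈ limitedChange m n n₀ L)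
    (J : Finset (Fin L × ClassPair m)) (d : Fin L × ClassPair m → ℝ) :
    0 < noiseSum n₀ H pen Λ (fittedVector H z (truncate J d)) a ∧
    Tensor.sqNorm (P.tensor H - Λ) / ((n : ℝ) ^ 2 * (L : ℝ)) ≤ oracleTerm n₀ H Λ z J d +
      16 * Real.log (noiseSum n₀ H pen Λ (fittedVector H z (truncate J d)) a)
        / ((n : ℝ) ^ 2 * (L : ℝ)) := by
  classical
  set y := fittedVector H z (truncate J d) with hy
  obtain ⟨hfeas, hmin⟩ := hP
  set V := fitSpace H P.z P.J y with hV
  set Y : ℝ := ‖V.starProjection (WithLp.toLp 2 (a - vectorize Λ))‖ ^ 2 - pen P.m P.J.card / 4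
    with hY
  -- The selected model is random, but its term is one of the nonnegative summands.
  have hexp : Real.exp Y ≤ noiseSum n₀ H pen Λ y a := by
    have h1 : Real.exp Y = Real.exp (-(pen P.m P.J.card / 4)) * Real.exp
        (‖V.starProjection (WithLp.toLp 2 (a - vectorize Λ))‖ ^ 2) := by
      rw [← Real.exp_add, hY]
      congr 1
      ring
    rw [h1]
    unfold noiseSum
    have hterm : ∀ (m : ℕ) (z : Clustering m n L) (J : Finset (Fin L × ClassPair m)),
        0 ≤ Real.exp (-(pen m J.card / 4)) * Real.exp
          (‖(fitSpace H z J y).starProjection (WithLp.toLp 2 (a - vectorize Λ))‖ ^ 2) :=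
      fun _ _ _ => by positivity
    refine le_trans ?_ (Finset.single_le_sum (fun m _ => Finset.sum_nonneg fun z _ =>
      Finset.sum_nonneg fun J _ => hterm m z J)
      (Finset.mem_Icc.mpr ⟨hfeas.one_le, hfeas.le_n⟩))
    refine le_trans ?_ (Finset.single_le_sum (fun z _ =>
      Finset.sum_nonneg fun J _ => hterm P.m z J) (Set.mem_toFinset.mpr hfeas.mem))
    exact Finset.single_le_sum (f := fun J : Finset (Fin L × ClassPair P.m) =>
      Real.exp (-(pen P.m J.card / 4)) * Real.exp
        (‖(fitSpace H P.z J y).starProjection (WithLp.toLp 2 (a - vectorize Λ))‖ ^ 2))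
      (fun J _ => hterm P.m P.z J) (Finset.mem_univ P.J)
  have hpos : 0 < noiseSum n₀ H pen Λ y a := (Real.exp_pos Y).trans_le hexp
  refine ⟨hpos, ?_⟩
  have hlog : Y ≤ Real.log (noiseSum n₀ H pen Λ y a) := (Real.le_log_iff_exp_le hpos).mpr hexp
  have hobj := hmin ⟨m, z, J, truncate J d⟩ ⟨hm, hmn, hz, fun j hj => by simp [truncate, hj]⟩
  unfold objective at hobj
  rw [sqNorm_eq_norm_sq, sqNorm_eq_norm_sq, WithLp.toLp_sub, WithLp.toLp_sub] at hobj
  have hdet := norm_sq_sub_le_of_penalized V (s := WithLp.toLp 2 (vectorize Λ))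
    (sub_mem_fitSpace H P.z P.J y P.d hfeas.vanish) hobj
  rw [← WithLp.toLp_sub, ← WithLp.toLp_sub, ← WithLp.toLp_sub, ← sqNorm_eq_norm_sq,
    ← sqNorm_eq_norm_sq] at hdet
  have hp := hpen m J.card hm
  have hn' : (0 : ℝ) < n := by exact_mod_cast hn
  have hL' : (0 : ℝ) < L := by exact_mod_cast hL
  unfold oracleTerm Params.tensor
  -- After doubling, the noise and the penalty of the selected model combine to `16 Y`, which `hlog`
  -- bounds.
  rw [sqNorm_pack_sub _ hΛ, ← add_div, ← add_div]
  gcongr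
  simp only at hdet
  linarith

lemma oracleTerm_nonneg {n n₀ L : ℕ} (hL : 1 ≤ L) (hn₀ : n₀ ≤ n)
    (H : Matrix (Fin L) (Fin L) ℝ) (Λ : Tensor n L) {m : ℕ} (hm : 1 ≤ m) (z : Clustering m n L)
    (J : Finset (Fin L × ClassPair m)) (d : Fin L × ClassPair m → ℝ) :
    0 ≤ oracleTerm n₀ H Λ z J d := by
  have h1 : 0 ≤ explicitPenalty n n₀ L m J.card :=
    (cardPenalty_nonneg ((Finset.card_le_univ J).trans (card_index_le m L))).trans
      (cardPenalty_le_explicitPenalty hL hm hn₀ _)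
  unfold oracleTerm sqNorm
  positivity

/-- There is a competitor whose oracle term is minimal up to `ε`. -/
lemma exists_oracleTerm_le_add {n n₀ L : ℕ} (hn : 1 ≤ n) (hL : 1 ≤ L) (hn₀ : n₀ ≤ n)
    (H : Matrix (Fin L) (Fin L) ℝ) (Λ : Tensor n L) {ε : ℝ} (hε : 0 < ε) :
    ∃ (m' : ℕ) (z' : Clustering m' n L) (J' : Finset (Fin L × ClassPair m'))
      (d' : Fin L × ClassPair m' → ℝ), 1 ≤ m' ∧ m' ≤ n ∧ z' ∈ limitedChange m' n n₀ L ∧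
      ∀ m : ℕ, 1 ≤ m → m ≤ n → ∀ z ∈ limitedChange m n n₀ L,
      ∀ (J : Finset (Fin L × ClassPair m)) (d : Fin L × ClassPair m → ℝ),
        oracleTerm n₀ H Λ z' J' d' ≤ oracleTerm n₀ H Λ z J d + ε := by
  set R : Set ℝ := {r | ∃ (m' : ℕ) (z' : Clustering m' n L) (J' : Finset (Fin L × ClassPair m'))
      (d' : Fin L × ClassPair m' → ℝ), 1 ≤ m' ∧ m' ≤ n ∧ z' ∈ limitedChange m' n n₀ L ∧
      oracleTerm n₀ H Λ z' J' d' = r} with hR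
  have hbdd : BddBelow R := by
    refine ⟨0, ?_⟩
    rintro r ⟨m, z, J, d, hm, -, -, rfl⟩
    exact oracleTerm_nonneg hL hn₀ H Λ hm z J d
  have hne : R.Nonempty :=
    ⟨_, 1, fun _ _ => 0, ∅, 0, le_rfl, hn, fun l l' _ => by simp, rfl⟩
  obtain ⟨r, ⟨m', z', J', d', hm, hmn, hz, rfl⟩, hlt⟩ :=
    exists_lt_of_csInf_lt hne (lt_add_of_pos_right (sInf R) hε)
  refine ⟨m', z', J', d', hm, hmn, hz, fun m hm hmn z hz J d => hlt.le.trans ?_⟩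
  gcongr
  exact csInf_le hbdd ⟨m, z, J, d, hm, hmn, hz, rfl⟩

end DSBM

end

/-! ### Deviation bound and expectation bound. -/

theorem corollary1 {Ω : Type*} [MeasurableSpace Ω] (μ : Measure Ω) [IsProbabilityMeasure μ]
    (n n₀ L : ℕ) (hn : 1 ≤ n) (hL : 1 ≤ L) (hn₀ : n₀ ≤ n)
    (H : Matrix (Fin L) (Fin L) ℝ) (hH : H ∈ Matrix.orthogonalGroup (Fin L) ℝ)
    (Λ : DSBM.Tensor n L) (hΛ : DSBM.IsBlockTensor Λ)
    (B : Ω → DSBM.Tensor n L) (hB : DSBM.IsNetwork μ B Λ)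
    -- the estimator may be computed with the cardinality penalty or with the explicit one
    (pen : ℕ → ℕ → ℝ)
    (hpen : pen = DSBM.cardPenalty n n₀ L ∨ pen = DSBM.explicitPenalty n n₀ L)
    -- a choice of one of the solutions for each data vector
    (est : (Fin L × DSBM.NodePair n → ℝ) → DSBM.Params n L)
    (hest : ∀ ω, DSBM.IsSolution n₀ H pen (DSBM.vectorize (B ω)) (est (DSBM.vectorize (B ω)))) :
    (∀ t : ℝ, 0 < t →
      1 - 9 * Real.exp (-t) ≤
        μ.real {ω | ∀ m : ℕ, 1 ≤ m → m ≤ n →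
          ∀ z ∈ DSBM.limitedChange m n n₀ L,
          ∀ (J : Finset (Fin L × DSBM.ClassPair m)) (d : Fin L × DSBM.ClassPair m → ℝ),
          DSBM.Tensor.sqNorm ((est (DSBM.vectorize (B ω))).tensor H - Λ) / ((n : ℝ) ^ 2 * (L : ℝ))
            ≤ DSBM.oracleTerm n₀ H Λ z J d + 38 * t / ((n : ℝ) ^ 2 * (L : ℝ))}) ∧
    Integrable (fun ω =>
      DSBM.Tensor.sqNorm ((est (DSBM.vectorize (B ω))).tensor H - Λ)
        / ((n : ℝ) ^ 2 * (L : ℝ))) μ ∧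
    ∀ m : ℕ, 1 ≤ m → m ≤ n →
      ∀ z ∈ DSBM.limitedChange m n n₀ L,
      ∀ (J : Finset (Fin L × DSBM.ClassPair m)) (d : Fin L × DSBM.ClassPair m → ℝ),
      ∫ ω, DSBM.Tensor.sqNorm ((est (DSBM.vectorize (B ω))).tensor H - Λ)
          / ((n : ℝ) ^ 2 * (L : ℝ)) ∂μ
        ≤ DSBM.oracleTerm n₀ H Λ z J d + 342 / ((n : ℝ) ^ 2 * (L : ℝ)) := by
  have hlower : ∀ m k, 1 ≤ m → DSBM.cardPenalty n n₀ L m k ≤ pen m k := by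
    rcases hpen with rfl | rfl
    · exact fun _ _ _ => le_rfl
    · exact fun m k hm => DSBM.cardPenalty_le_explicitPenalty hL hm hn₀ k
  have hupper : ∀ m k, 1 ≤ m → pen m k ≤ DSBM.explicitPenalty n n₀ L m k := by
    rcases hpen with rfl | rfl
    · exact fun m k hm => DSBM.cardPenalty_le_explicitPenalty hL hm hn₀ k
    · exact fun _ _ _ => le_rfl
  have hn' : (0 : ℝ) < n := by exact_mod_cast hn
  have hL' : (0 : ℝ) < L := by exact_mod_cast hL
  have hnL : (0 : ℝ) < (n : ℝ) ^ 2 * L := by positivity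
  -- The estimator is a function of data with finitely many values, so its selection rule need not
  -- be measurable.
  have hint : Integrable (fun ω =>
      DSBM.Tensor.sqNorm ((est (DSBM.vectorize (B ω))).tensor H - Λ)
        / ((n : ℝ) ^ 2 * (L : ℝ))) μ :=
    hB.integrable_comp fun a => DSBM.Tensor.sqNorm ((est a).tensor H - Λ) / ((n : ℝ) ^ 2 * (L : ℝ))
  refine ⟨fun t ht => ?_, hint, fun m hm hmn z hz J d => ?_⟩
  -- The event must hold for all competitors at once, while `S` depends on the competitor. One
  -- nearly optimal competitor is therefore fixed, with the tolerance `22 t = 38 t - 16 t`; no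
  -- minimum has to be attained.
  · obtain ⟨m', z', J', d', hm', hmn', hz', hmin⟩ := DSBM.exists_oracleTerm_le_add hn hL hn₀ H Λ
      (show 0 < 22 * t / ((n : ℝ) ^ 2 * L) by positivity)
    set S : Ω → ℝ := fun ω => DSBM.noiseSum n₀ H pen Λ
      (DSBM.fittedVector H z' (DSBM.truncate J' d')) (DSBM.vectorize (B ω)) with hS
    have hkey := fun ω => DSBM.sqNorm_tensor_sub_le hn hL H hΛ hupper (hest ω) hm' hmn' hz' J' d'
    have hSint : Integrable S μ := hB.integrable_comp _
    have hSle : ∫ ω, S ω ∂μ ≤ 4 := DSBM.integral_noiseSum_le hn hL H hB hlower _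
    have hmarkov := mul_meas_ge_le_integral_of_nonneg
      (Filter.Eventually.of_forall fun ω => (hkey ω).1.le) hSint (Real.exp t)
    have hmeas : NullMeasurableSet {ω | Real.exp t ≤ S ω} μ :=
      nullMeasurableSet_le aemeasurable_const hSint.aemeasurable
    have hprob : μ.real {ω | Real.exp t ≤ S ω} ≤ 4 * Real.exp (-t) := by
      rw [Real.exp_neg, ← div_eq_mul_inv, le_div_iff₀ (Real.exp_pos t), mul_comm]
      exact hmarkov.trans hSle
    have hcompl : μ.real {ω | Real.exp t ≤ S ω}ᶜ = 1 - μ.real {ω | Real.exp t ≤ S ω} :=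
      probReal_compl_eq_one_sub₀ hmeas
    calc 1 - 9 * Real.exp (-t) ≤ μ.real {ω | Real.exp t ≤ S ω}ᶜ := by
          rw [hcompl]
          linarith [Real.exp_pos (-t)]
      _ ≤ _ := by
          refine measureReal_mono ?_
          intro ω hω m hm hmn z hz J d
          have hω' : S ω < Real.exp t := not_le.mp hω
          have hlog : Real.log (S ω) ≤ t := (Real.log_le_iff_le_exp (hkey ω).1).mpr hω'.le
          have h1 : 16 * Real.log (S ω) / ((n : ℝ) ^ 2 * L) ≤ 16 * t / ((n : ℝ) ^ 2 * L) := by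
            gcongr
          have h2 := (hkey ω).2
          have h3 := hmin m hm hmn z hz J d
          have h4 : 38 * t / ((n : ℝ) ^ 2 * L) =
              16 * t / ((n : ℝ) ^ 2 * L) + 22 * t / ((n : ℝ) ^ 2 * L) := by ring
          simp only [hS] at h1
          linarith
  · set S : Ω → ℝ := fun ω => DSBM.noiseSum n₀ H pen Λ
      (DSBM.fittedVector H z (DSBM.truncate J d)) (DSBM.vectorize (B ω)) with hS
    have hkey := fun ω => DSBM.sqNorm_tensor_sub_le hn hL H hΛ hupper (hest ω) hm hmn hz J d
    have hSint : Integrable S μ := hB.integrable_comp _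
    have hSle : ∫ ω, S ω ∂μ ≤ 4 := DSBM.integral_noiseSum_le hn hL H hB hlower _
    calc ∫ ω, DSBM.Tensor.sqNorm ((est (DSBM.vectorize (B ω))).tensor H - Λ)
          / ((n : ℝ) ^ 2 * (L : ℝ)) ∂μ
        ≤ ∫ ω, (DSBM.oracleTerm n₀ H Λ z J d + 16 / ((n : ℝ) ^ 2 * L) * S ω) ∂μ := by
          refine integral_mono hint ((integrable_const _).add (hSint.const_mul _)) fun ω => ?_
          refine (hkey ω).2.trans ?_
          rw [mul_div_right_comm]
          gcongr
          -- `log S ≤ S - 1 ≤ S`; the remainder then has mean at most `16 * 4 = 64`, below `342`.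
          exact (Real.log_le_sub_one_of_pos (hkey ω).1).trans (by linarith)
      _ = DSBM.oracleTerm n₀ H Λ z J d + 16 / ((n : ℝ) ^ 2 * L) * ∫ ω, S ω ∂μ := by
          rw [integral_add (integrable_const _) (hSint.const_mul _), integral_const_mul]
          simp
      _ ≤ DSBM.oracleTerm n₀ H Λ z J d + 16 / ((n : ℝ) ^ 2 * L) * 4 := by gcongr
      _ ≤ _ := by
          rw [div_mul_eq_mul_div]
          gcongr
          norm_num
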